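/- **Setting.** Let $N\ge 1$, $y\ge 2$ be integers, $\Sigma=\{-1,+1\}^N$, and let $E:\Sigma\to[0,\infty)$ satisfy $\min_\Sigma E=0$. Write $x=(\sigma^1,\dots,\sigma^y)$ for the elements of $\Sigma^y$. For $\beta,\gamma>0$ put $$H_\gamma(x)=\sum_{i=1}^N\log\cosh\Big(\gamma\sum_{a=1}^y\sigma^a_i\Big),\qquad F_{\beta,\gamma}(x)=\sum_{a=1}^yE(\sigma^a)-\frac1\beta H_\gamma(x),$$ and let $\overline Q_{\beta,\gamma}$ be the probability measure on $\Sigma^y$ proportional to $e^{-\beta F_{\beta,\gamma}}=\exp\big(-\beta\sum_aE(\sigma^a)+H_\gamma\big)$. Let $\Pi$ be the proposal chain on $\Sigma^y$ that picks $a\in\{1,\dots,y\}$ and $i\in\{1,\dots,N\}$ uniformly at random and flips $\sigma^a_i$, and let $S_{\beta,\gamma}$ be the Metropolis matrix $$S_{\beta,\gamma}(x,z)=e^{-\beta(F_{\beta,\gamma}(z)-F_{\beta,\gamma}(x))^+}\,\Pi(x,z)\quad(x\ne z),\qquad S_{\beta,\gamma}(x,x)=1-\sum_{z\ne x}S_{\beta,\gamma}(x,z).$$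 Let $$m(\beta,\gamma)=\max_{x,z}\Big(\min_{p:x\to z}\ \max_{w\in p}F_{\beta,\gamma}(w)-F_{\beta,\gamma}(x)-F_{\beta,\gamma}(z)\Big)+\min F_{\beta,\gamma},$$ where $p$ ranges over the paths of single spin flips from $x$ to $z$. Let $B=\min\{E(\sigma):E(\sigma)\neq0\}$ ($B=0$ if $E\equiv0$) and $B'(\gamma)=\log\cosh(\gamma y)-\log\cosh(\gamma(y-2))$. Fix $\gamma_*>0$. Call $(C,\kappa_3)$ *admissible* if $0<C<1$, $\kappa_3>0$ and, for all $\beta>0$, $\gamma\ge\gamma_*$, $T\in\mathbb N_0$ and all $\rho:\Sigma^y\to\mathbb R$ with $\sum_x\rho(x)=0$, $$\|\rho\,S_{\beta,\gamma}^T\|_\infty\le\kappa_3\,\big(1-Ce^{-\beta m(\beta,\gamma)}\big)^T\,\|\rho\|_\infty .$$ **Theorem 3.4.** There are admissible pairs $(C,\kappa_3)$, even with $C\le 1-e^{-1}$. Moreover, let $(C,\kappa_3)$ be any admissible pair and $\kappa_2>0$. Let $(\beta_n)_{n\ge0}$, $(\gamma_n)_{n\ge0}$ be nondecreasing with $\beta_n>0$,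 $\gamma_n\ge\gamma_*$, $\beta_n\to\infty$ and $\gamma_n\to\infty$, let $T_n\in\mathbb N_0$, let $\nu_0$ be a probability measure on $\Sigma^y$, and let $\nu_n=\nu_{n-1}S_{\beta_n,\gamma_n}^{T_n}$ for $n\ge1$. Put $m_k=m(\beta_k,\gamma_k)$, $B'_k=B'(\gamma_k)$, $\varepsilon_0=\|\overline Q_{\beta_0,\gamma_0}-\nu_0\|_\infty$ and $u_n=\kappa_3^n\prod_{k=1}^n(1-Ce^{-\beta_km_k})^{T_k}$. If $$u_n\Big(\sum_{k=1}^n\frac{\kappa_2\,e^{-(\beta_kB+\gamma_kB'_k)}}{u_k}+\varepsilon_0\Big)\longrightarrow0\qquad(n\to\infty),\tag{$*$}$$ then $\overline Q_{\beta_n,\gamma_n}$ and $\nu_n$ converge to one and the same limit as $n\to\infty$. If moreover $C\le1-e^{-1}$, then a necessary condition for $(*)$ is $$\lim_{n\to\infty}\Big(-\sum_{k=1}^nT_ke^{-\beta_km_k}+n\log\kappa_3\Big)=-\infty .$$ -/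

import Mathlib

noncomputable section

namespace ReplicatedSA

/-- The spin configurations `{-1,+1}^N`. -/
abbrev Spins (N : ℕ) : Type := Fin N → ℤˣ

/-- The replicated state space: `y` copies of `{-1,+1}^N`. -/
abbrev Config (N y : ℕ) : Type := Fin y → Spins N

variable {N y : ℕ}

/-- Flip the `i`-th spin of the `a`-th replica. -/
def flip (x : Config N y) (a : Fin y) (i : Fin N) : Config N y :=
  Function.update x a (Function.update (x a) i (-(x a i)))

lemma flip_flip (x : Config N y) (a : Fin y) (i : Fin N) : flip (flip x a i) a i = x := by
  simp [flip]

lemma flip_ne (x : Config N y) (a : Fin y) (i : Fin N) : flip x a i ≠ x := by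
  intro h
  have h1 : -(x a i) = x a i := by
    have h0 := congrFun (congrFun h a) i
    simp only [flip, Function.update_self] at h0
    exact h0
  have h2 : ((-(x a i) : ℤˣ) : ℤ) = ((x a i : ℤˣ) : ℤ) := congrArg _ h1
  have h3 : ((x a i : ℤˣ) : ℤ) ≠ 0 := Units.ne_zero _
  rw [Units.val_neg] at h2
  omega

/-- The graph of single spin flips on the replicated state space; its walks are the paths of
the dynamics. -/
def flipGraph (N y : ℕ) : SimpleGraph (Config N y) where
  Adj x z := ∃ a i, z = flip x a i
  symm := ⟨by
    rintro x z ⟨a, i, rfl⟩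
    exact ⟨a, i, (flip_flip x a i).symm⟩⟩
  loopless := ⟨by
    rintro x ⟨a, i, h⟩
    exact flip_ne x a i h.symm⟩

/-- The proposal chain: choose a replica and a coordinate uniformly at random and flip that
spin. -/
def proposal (x z : Config N y) : ℝ :=
  (∑ a : Fin y, ∑ i : Fin N, if z = flip x a i then (1 : ℝ) else 0) / ((N : ℝ) * (y : ℝ))

/-- `∑_a E(σ^a)`. -/
def totalEnergy (E : Spins N → ℝ) (x : Config N y) : ℝ := ∑ a, E (x a)

/-- `∑_i log cosh (γ ∑_a σ_i^a)`. -/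
def coupling (γ : ℝ) (x : Config N y) : ℝ :=
  ∑ i : Fin N, Real.log (Real.cosh (γ * ∑ a : Fin y, ((x a i : ℤ) : ℝ)))

/-- The measure `Q̄_{β,γ}`. -/
def Qbar (E : Spins N → ℝ) (β γ : ℝ) (x : Config N y) : ℝ :=
  Real.exp (-β * totalEnergy E x + coupling γ x) /
    ∑ z : Config N y, Real.exp (-β * totalEnergy E z + coupling γ z)

/-- The parameter-dependent energy `F`, so that `Q̄_{β,γ}` is proportional to `exp (-β F)`. -/
def energy (E : Spins N → ℝ) (β γ : ℝ) (x : Config N y) : ℝ :=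
  totalEnergy E x - coupling γ x / β

/-- The Metropolis transition matrix `S_{β,γ}` with energy `F` at inverse temperature `β`. -/
def metropolis (E : Spins N → ℝ) (β γ : ℝ) : Matrix (Config N y) (Config N y) ℝ :=
  Matrix.of fun x z =>
    if x = z then
      1 - ∑ w ∈ Finset.univ.erase x,
        Real.exp (-β * max (energy E β γ w - energy E β γ x) 0) * proposal x w
    else Real.exp (-β * max (energy E β γ z - energy E β γ x) 0) * proposal x z

/-- The elevation of a path: the largest energy of a vertex on it. -/
def elevation (F : Config N y → ℝ) {x z : Config N y} (p : (flipGraph N y).Walk x z) : ℝ :=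
  sSup (F '' {w | w ∈ p.support})

/-- The lowest elevation of a path from `x` to `z`. -/
def commHeight (F : Config N y → ℝ) (x z : Config N y) : ℝ :=
  ⨅ p : (flipGraph N y).Walk x z, elevation F p

/-- `max_{x,z} (H(x,z) - F(x) - F(z))` for the energy `F - min F`, that is,
`max_{x,z} (H(x,z) - F(x) - F(z)) + min F` for the unnormalized `F`. -/
def barrier (F : Config N y → ℝ) : ℝ :=
  (⨆ q : Config N y × Config N y, (commHeight F q.1 q.2 - F q.1 - F q.2)) + ⨅ x, F x

/-- The critical height `m` of the energy at parameters `β, γ`. -/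
def critHeight (y : ℕ) (E : Spins N → ℝ) (β γ : ℝ) : ℝ :=
  barrier (energy E β γ : Config N y → ℝ)

/-- The smallest nonzero value of `E` (and `0` if `E` vanishes identically). -/
def energyGap (E : Spins N → ℝ) : ℝ := sInf {e : ℝ | e ≠ 0 ∧ ∃ σ, E σ = e}

/-- `B' = log cosh (γ y) - log cosh (γ (y - 2))`: the gap between the largest and the second
largest value of `coupling γ`. -/
def couplingGap (y : ℕ) (γ : ℝ) : ℝ :=
  Real.log (Real.cosh (γ * (y : ℝ))) - Real.log (Real.cosh (γ * ((y : ℝ) - 2)))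

/-- The law `ν_n` of the annealing process after the first `n` blocks; in block `k` the chain
makes `T k` steps with parameters `β k, γ k`. -/
def law (E : Spins N → ℝ) (β γ : ℕ → ℝ) (T : ℕ → ℕ) (ν₀ : Config N y → ℝ) :
    ℕ → Config N y → ℝ
  | 0 => ν₀
  | n + 1 => Matrix.vecMul (law E β γ T ν₀ n)
      ((metropolis E (β (n + 1)) (γ (n + 1))) ^ (T (n + 1)))

/-- `C` and `κ₃` are constants in the contraction estimate for the Metropolis matrices with
`γ ≥ γ₀`: in the supremum norm, a signed measure of total mass zero is contracted in `T` steps by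
`κ₃ (1 - C e^{-β m})^T`. -/
structure IsContractionPair (y : ℕ) (E : Spins N → ℝ) (γ₀ C κ₃ : ℝ) : Prop where
  C_pos : 0 < C
  C_lt_one : C < 1
  κ₃_pos : 0 < κ₃
  bound : ∀ β γ : ℝ, 0 < β → γ₀ ≤ γ → ∀ (T : ℕ) (ρ : Config N y → ℝ), ∑ x, ρ x = 0 →
    ‖Matrix.vecMul ρ ((metropolis E β γ) ^ T)‖ ≤
      κ₃ * (1 - C * Real.exp (-β * critHeight y E β γ)) ^ T * ‖ρ‖

/-- `u_n = κ₃^n ∏_{k=1}^n (1 - C e^{-β_k m_k})^{T_k}`. -/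
def uSeq (y : ℕ) (E : Spins N → ℝ) (β γ : ℕ → ℝ) (T : ℕ → ℕ) (C κ₃ : ℝ) (n : ℕ) : ℝ :=
  κ₃ ^ n * ∏ k ∈ Finset.Icc 1 n,
    (1 - C * Real.exp (-β k * critHeight y E (β k) (γ k))) ^ (T k)

/-- `u_n (∑_{k=1}^n κ₂ e^{-(β_k B + γ_k B'_k)} / u_k + ε₀)`, where
`ε₀ = ‖Q̄_{β_0,γ_0} - ν_0‖_∞`. -/
def errorBound (E : Spins N → ℝ) (β γ : ℕ → ℝ) (T : ℕ → ℕ) (ν₀ : Config N y → ℝ)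
    (C κ₂ κ₃ : ℝ) (n : ℕ) : ℝ :=
  uSeq y E β γ T C κ₃ n *
    ((∑ k ∈ Finset.Icc 1 n,
        κ₂ * Real.exp (-(β k * energyGap E + γ k * couplingGap y (γ k))) /
          uSeq y E β γ T C κ₃ k)
      + ‖(Qbar E (β 0) (γ 0) : Config N y → ℝ) - ν₀‖)

end ReplicatedSA

end

noncomputable section

/-! ### Stochastic matrices acting on signed measures of mass zero -/

namespace MarkovMatrix

open Matrix Finset

/-! Admissible pairs come from a Doeblin minorization at a replicated ground state `o = (σ,…,σ)`
with `E σ = 0`, a global minimum of `F`. A path of lowest elevation from `z` to `o` has resistance,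
relative to the weight of `z`, at most a constant times `e^{βm}`. This bounds the Green function of
the chain killed at `o`, hence the expected hitting time of `o` (`green_le`,
`sum_survival_eq_sum_green`). Leaving `o` costs at least `B'(γ) ≥ B'(γ_*) > 0` in `βF`, so the
holding probability at `o` is bounded below uniformly; with reversibility this keeps the return
probabilities to `o` bounded below at all times. Thus `S^τ(x,o) ≥ c` with `τ` of order `e^{βm}`
(`minorization`), which iterates to the required rate (`norm_vecMul_pow_le`).

For the convergence, `(*)` enters through `u_n → 0`, visible from the `k = 1` term alone. Normalized
to be one at replicated ground states, the Gibbs weights decrease in `β` and in `γ`. So they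
converge, and the total `ℓ¹` variation of `Q̄_n` is bounded by a telescoping sum of partition
functions. The difference `ν_n - Q̄_n` is a contracted evolution with summable perturbations and
tends to zero (`tendsto_zero_of_contraction`).

The necessary condition is `log u_n → -∞` combined with `e^{-x} ≤ 1 - Cx` on `[0,1]`, a consequence
of convexity. -/

lemma abs_sub_le_length_mul {X : Type*} {G : SimpleGraph X} (g : X → ℝ) {s : ℝ} {x y : X}
    (p : G.Walk x y)
    (h : ∀ a ∈ p.support, ∀ b ∈ p.support, G.Adj a b → |g a - g b| ≤ s) :
    |g x - g y| ≤ p.length * s := by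
  induction p with
  | nil => simp
  | @cons u v v' huv p ih =>
    have h1 := h u (by simp) v (by simp) huv
    have h2 := ih fun a ha b hb hab => h a (by simp [ha]) b (by simp [hb]) hab
    have h3 := abs_sub_le (g u) (g v) (g v')
    rw [SimpleGraph.Walk.length_cons]
    push_cast
    linarith

variable {X : Type*} [Fintype X]

lemma norm_le_sum_abs (ρ : X → ℝ) : ‖ρ‖ ≤ ∑ x, |ρ x| := by
  refine (pi_norm_le_iff_of_nonneg (Finset.sum_nonneg fun x _ => abs_nonneg _)).2 fun x => ?_
  rw [Real.norm_eq_abs]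
  exact Finset.single_le_sum (f := fun x => |ρ x|) (fun x _ => abs_nonneg _) (Finset.mem_univ x)

lemma sum_abs_le_card_mul_norm (ρ : X → ℝ) : ∑ x, |ρ x| ≤ Fintype.card X * ‖ρ‖ := by
  simpa [nsmul_eq_mul] using Pi.sum_norm_apply_le_norm ρ

/-- A nonnegative matrix with constant row sums `r` expands the `ℓ¹` norm of row vectors by at
most `r`. -/
lemma sum_abs_vecMul_le {R : Matrix X X ℝ} {r : ℝ} (h0 : ∀ x z, 0 ≤ R x z)
    (hr : ∀ x, ∑ z, R x z = r) (ρ : X → ℝ) : ∑ z, |(ρ ᵥ* R) z| ≤ r * ∑ x, |ρ x| := by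
  calc ∑ z, |(ρ ᵥ* R) z| ≤ ∑ z, ∑ x, |ρ x| * R x z := by
        refine Finset.sum_le_sum fun z _ => ?_
        refine (Finset.abs_sum_le_sum_abs _ _).trans_eq ?_
        exact Finset.sum_congr rfl fun x _ => by rw [abs_mul, abs_of_nonneg (h0 x z)]
    _ = ∑ x, |ρ x| * r := by
        rw [Finset.sum_comm]
        exact Finset.sum_congr rfl fun x _ => by rw [← Finset.mul_sum, hr]
    _ = r * ∑ x, |ρ x| := by rw [← Finset.sum_mul, mul_comm]

/-- A decrease of the weights moves the normalized weights in `ℓ¹` by at most twice the decrease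
of the total weight, if the latter stays above `1`. -/
lemma sum_abs_normalized_sub_le {v w : X → ℝ} (hv : ∀ x, 0 ≤ v x) (hvw : ∀ x, v x ≤ w x)
    (h1 : 1 ≤ ∑ x, v x) :
    ∑ x, |w x / ∑ z, w z - v x / ∑ z, v z| ≤ 2 * ∑ x, w x - 2 * ∑ x, v x := by
  set V := ∑ z, v z with hV
  set W := ∑ z, w z with hW
  have hVW : V ≤ W := Finset.sum_le_sum fun x _ => hvw x
  have hV0 : 0 < V := by linarith
  have hW0 : 0 < W := by linarith
  calc ∑ x, |w x / W - v x / V| ≤ ∑ x, ((w x - v x) / V + w x * ((W - V) / (V * W))) := by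
        refine Finset.sum_le_sum fun x _ => ?_
        -- The change of numerator and the change of denominator each contribute `(W - V) / V` after
        -- summation.
        have hsplit : w x / W - v x / V = (w x - v x) / V - w x * ((W - V) / (V * W)) := by
          field_simp
          ring
        have ha : 0 ≤ (w x - v x) / V := div_nonneg (sub_nonneg.2 (hvw x)) hV0.le
        have hb : 0 ≤ w x * ((W - V) / (V * W)) :=
          mul_nonneg ((hv x).trans (hvw x)) (div_nonneg (sub_nonneg.2 hVW) (by positivity))
        rw [hsplit]
        exact abs_le.2 ⟨by linarith, by linarith⟩
    _ = 2 * ((W - V) / V) := by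
        rw [Finset.sum_add_distrib, ← Finset.sum_div, Finset.sum_sub_distrib, ← Finset.sum_mul,
          ← hV, ← hW]
        field_simp
        ring
    _ ≤ 2 * W - 2 * V := by
        have := div_le_self (sub_nonneg.2 hVW) h1
        linarith

variable [DecidableEq X]

lemma sum_abs_vecMul_le_of_mem {S : Matrix X X ℝ} (hS : S ∈ rowStochastic ℝ X) (ρ : X → ℝ) :
    ∑ z, |(ρ ᵥ* S) z| ≤ ∑ x, |ρ x| := by
  simpa using sum_abs_vecMul_le (fun x z => nonneg_of_mem_rowStochastic hS)
    (sum_row_of_mem_rowStochastic hS) ρ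

lemma sum_vecMul {S : Matrix X X ℝ} (hS : S ∈ rowStochastic ℝ X) (ρ : X → ℝ) :
    ∑ z, (ρ ᵥ* S) z = ∑ x, ρ x := by
  simp only [vecMul, dotProduct]
  rw [Finset.sum_comm]
  exact Finset.sum_congr rfl fun x _ => by
    rw [← Finset.mul_sum, sum_row_of_mem_rowStochastic hS, mul_one]

/-- Doeblin's condition at a single state gives a contraction of signed measures of mass zero. -/
lemma sum_abs_vecMul_le_of_minorization {P : Matrix X X ℝ} (hP : P ∈ rowStochastic ℝ X) {o : X}
    {c : ℝ} (hc : ∀ x, c ≤ P x o) {ρ : X → ℝ} (hρ : ∑ x, ρ x = 0) :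
    ∑ z, |(ρ ᵥ* P) z| ≤ (1 - c) * ∑ x, |ρ x| := by
  -- Subtracting the constant `c` from column `o` does not affect measures of mass zero, and leaves
  -- a nonnegative matrix with row sums `1 - c`.
  set R : Matrix X X ℝ := fun x z => P x z - if z = o then c else 0 with hR
  have hvec : ρ ᵥ* P = ρ ᵥ* R := by
    ext z
    simp only [vecMul, dotProduct, hR, mul_sub, Finset.sum_sub_distrib]
    rw [← Finset.sum_mul, hρ]
    simp
  rw [hvec]
  refine sum_abs_vecMul_le (fun x z => ?_) (fun x => ?_) ρ
  · by_cases h : z = o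
    · subst h
      simpa [hR] using hc x
    · simpa [hR, h] using nonneg_of_mem_rowStochastic hP
  · simp [hR, Finset.sum_sub_distrib, sum_row_of_mem_rowStochastic hP]

/-- Mass zero is preserved at each step, so the one-step contraction iterates. -/
lemma sum_abs_vecMul_pow_le_of_minorization {P : Matrix X X ℝ} (hP : P ∈ rowStochastic ℝ X)
    {o : X} {c : ℝ} (hc : ∀ x, c ≤ P x o) (hc1 : c ≤ 1) {ρ : X → ℝ} (hρ : ∑ x, ρ x = 0)
    (q : ℕ) : ∑ z, |(ρ ᵥ* P ^ q) z| ≤ (1 - c) ^ q * ∑ x, |ρ x| := by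
  induction q with
  | zero => simp
  | succ q ih =>
    rw [pow_succ, ← vecMul_vecMul, pow_succ, mul_comm ((1 - c) ^ q), mul_assoc]
    refine (sum_abs_vecMul_le_of_minorization hP hc ?_).trans ?_
    · rw [sum_vecMul (pow_mem hP q), hρ]
    · exact mul_le_mul_of_nonneg_left ih (by linarith)

/-- A minorization for the `τ`-step matrix gives geometric decay in the supremum norm. -/
lemma norm_vecMul_pow_le {S : Matrix X X ℝ} (hS : S ∈ rowStochastic ℝ X) {o : X}
    {c a : ℝ} {τ : ℕ} (hτ : 0 < τ) (hc : ∀ x, c ≤ (S ^ τ) x o) (hc1 : c < 1) (ha : 0 ≤ a)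
    (ha1 : a ≤ 1) (haτ : τ * a ≤ c) {ρ : X → ℝ} (hρ : ∑ x, ρ x = 0) (T : ℕ) :
    ‖ρ ᵥ* S ^ T‖ ≤ Fintype.card X / (1 - c) * (1 - a) ^ T * ‖ρ‖ := by
  set q := T / τ
  set r := T % τ
  have hT : T = τ * q + r := (Nat.div_add_mod T τ).symm
  have hr : r ≤ τ := (Nat.mod_lt _ hτ).le
  -- Bernoulli's inequality turns the contraction per block of `τ` steps into a rate per step.
  have hb : 1 - c ≤ (1 - a) ^ τ := by
    have := one_add_mul_le_pow (a := -a) (by linarith) τ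
    rw [← sub_eq_add_neg] at this
    linarith
  have h1a : 0 ≤ 1 - a := by linarith
  have h1c : 0 < 1 - c := by linarith
  -- The `r ≤ τ` leftover steps cost at most one more block, which is the factor `1 / (1 - c)`.
  have hpow : (1 - c) ^ q ≤ (1 - a) ^ T / (1 - c) := by
    rw [le_div_iff₀ h1c, hT, pow_add, pow_mul]
    refine mul_le_mul (pow_le_pow_left₀ h1c.le hb q) (hb.trans ?_) h1c.le (by positivity)
    exact pow_le_pow_of_le_one h1a (by linarith) hr
  calc ‖ρ ᵥ* S ^ T‖ ≤ ∑ z, |(ρ ᵥ* S ^ T) z| := norm_le_sum_abs _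
    _ = ∑ z, |((ρ ᵥ* (S ^ τ) ^ q) ᵥ* S ^ r) z| := by
        rw [vecMul_vecMul, ← pow_mul, ← pow_add, ← hT]
    _ ≤ ∑ z, |(ρ ᵥ* (S ^ τ) ^ q) z| := sum_abs_vecMul_le_of_mem (pow_mem hS r) _
    _ ≤ (1 - c) ^ q * ∑ x, |ρ x| :=
        sum_abs_vecMul_pow_le_of_minorization (pow_mem hS τ) hc hc1.le hρ q
    _ ≤ (1 - a) ^ T / (1 - c) * (Fintype.card X * ‖ρ‖) :=
        mul_le_mul hpow (sum_abs_le_card_mul_norm ρ)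
          (Finset.sum_nonneg fun x _ => abs_nonneg _) (by positivity)
    _ = Fintype.card X / (1 - c) * (1 - a) ^ T * ‖ρ‖ := by ring

/-! ### The chain killed at a state -/

/-- The transition operator of the chain killed at `o`. -/
def killed (S : Matrix X X ℝ) (o : X) (f : X → ℝ) (x : X) : ℝ :=
  if x = o then 0 else ∑ w, S x w * f w

/-- The expected number of visits to `z` before time `t` of the chain killed at `o`. -/
def green (S : Matrix X X ℝ) (o z : X) : ℕ → X → ℝ
  | 0 => 0
  | t + 1 => fun x => (if x = z then 1 else 0) + killed S o (green S o z t) x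

/-- The probability that the chain avoids `o` up to time `t`. -/
def survival (S : Matrix X X ℝ) (o : X) : ℕ → X → ℝ
  | 0 => fun x => if x = o then 0 else 1
  | t + 1 => killed S o (survival S o t)

lemma killed_mono {S : Matrix X X ℝ} (hS : S ∈ rowStochastic ℝ X) (o : X) {f g : X → ℝ}
    (h : ∀ x, f x ≤ g x) (x : X) : killed S o f x ≤ killed S o g x := by
  unfold killed
  split_ifs
  · exact le_rfl
  · exact Finset.sum_le_sum fun w _ =>
      mul_le_mul_of_nonneg_left (h w) (nonneg_of_mem_rowStochastic hS)

lemma killed_nonneg {S : Matrix X X ℝ} (hS : S ∈ rowStochastic ℝ X) (o : X) {f : X → ℝ}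
    (h : ∀ x, 0 ≤ f x) (x : X) : 0 ≤ killed S o f x := by
  unfold killed
  split_ifs
  · exact le_rfl
  · exact Finset.sum_nonneg fun w _ => mul_nonneg (nonneg_of_mem_rowStochastic hS) (h w)

lemma killed_le_of_le {S : Matrix X X ℝ} (hS : S ∈ rowStochastic ℝ X) (o : X) {f : X → ℝ} {b : ℝ}
    (hb : 0 ≤ b) (h : ∀ x, f x ≤ b) (x : X) : killed S o f x ≤ b := by
  unfold killed
  split_ifs
  · exact hb
  · calc ∑ w, S x w * f w ≤ ∑ w, S x w * b := Finset.sum_le_sum fun w _ =>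
          mul_le_mul_of_nonneg_left (h w) (nonneg_of_mem_rowStochastic hS)
      _ = b := by rw [← Finset.sum_mul, sum_row_of_mem_rowStochastic hS, one_mul]

lemma killed_sum (S : Matrix X X ℝ) (o : X) {ι : Type*} (s : Finset ι) (f : ι → X → ℝ) (x : X) :
    killed S o (fun w => ∑ i ∈ s, f i w) x = ∑ i ∈ s, killed S o (f i) x := by
  unfold killed
  split_ifs
  · simp
  · simp only [Finset.mul_sum]
    exact Finset.sum_comm

section Green

variable {S : Matrix X X ℝ} {o z : X}

lemma green_nonneg (hS : S ∈ rowStochastic ℝ X) (t : ℕ) : ∀ x, 0 ≤ green S o z t x := by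
  induction t with
  | zero => intro x; simp [green]
  | succ t ih =>
    intro x
    have := killed_nonneg hS o ih x
    simp only [green]
    split_ifs <;> linarith

lemma green_le_succ (hS : S ∈ rowStochastic ℝ X) (t : ℕ) :
    ∀ x, green S o z t x ≤ green S o z (t + 1) x := by
  induction t with
  | zero => intro x; simpa [green] using green_nonneg hS 1 x
  | succ t ih =>
    intro x
    have := killed_mono hS o ih x
    simp only [green] at this ⊢
    linarith

lemma green_self (hz : z ≠ o) (t : ℕ) : green S o z t o = 0 := by
  cases t with
  | zero => simp [green]
  | succ t => simp [green, killed, hz.symm]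

/-- Maximum principle: away from `z`, the Green function at time `t + 1` is a killed average of its
values at time `t`. -/
lemma green_le_green_pole (hS : S ∈ rowStochastic ℝ X) (t : ℕ) :
    ∀ x, green S o z t x ≤ green S o z t z := by
  induction t with
  | zero => intro x; simp [green]
  | succ t ih =>
    intro x
    rcases eq_or_ne x z with rfl | hx
    · exact le_rfl
    · refine le_trans ?_ (green_le_succ hS t z)
      simpa [green, hx] using killed_le_of_le hS o (green_nonneg hS t z) ih x

/-- The Dirichlet form of a reversible chain. -/
lemma sum_mul_sub_eq_dirichlet (hS : S ∈ rowStochastic ℝ X) {w : X → ℝ}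
    (hrev : ∀ x z, w x * S x z = w z * S z x) (g : X → ℝ) :
    ∑ x, w x * g x * (g x - ∑ z, S x z * g z) =
      (∑ x, ∑ z, w x * S x z * (g x - g z) ^ 2) / 2 := by
  have h1 : ∑ x, ∑ z, w x * S x z * g x ^ 2 = ∑ x, w x * g x ^ 2 :=
    Finset.sum_congr rfl fun x _ => by
      simp_rw [mul_assoc, mul_left_comm (w x)]
      rw [← Finset.sum_mul, sum_row_of_mem_rowStochastic hS, one_mul]
  have h2 : ∑ x, ∑ z, w x * S x z * g z ^ 2 = ∑ x, w x * g x ^ 2 := by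
    rw [← h1, Finset.sum_comm]
    exact Finset.sum_congr rfl fun x _ => Finset.sum_congr rfl fun z _ => by rw [hrev]
  have h3 : ∑ x, ∑ z, w x * S x z * (g x - g z) ^ 2 =
      ∑ x, ∑ z, w x * S x z * g x ^ 2 + ∑ x, ∑ z, w x * S x z * g z ^ 2
        - 2 * ∑ x, ∑ z, w x * g x * (S x z * g z) := by
    simp only [Finset.mul_sum, ← Finset.sum_add_distrib, ← Finset.sum_sub_distrib]
    exact Finset.sum_congr rfl fun x _ => Finset.sum_congr rfl fun z _ => by ring
  rw [h3, h1, h2]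
  have h4 : ∑ x, w x * g x * (g x - ∑ z, S x z * g z) =
      ∑ x, w x * g x ^ 2 - ∑ x, ∑ z, w x * g x * (S x z * g z) := by
    rw [← Finset.sum_sub_distrib]
    refine Finset.sum_congr rfl fun x _ => ?_
    rw [mul_sub, Finset.mul_sum]
    ring
  rw [h4]
  ring

/-- Since `green` increases in `t`, one has `g - S g ≤ δ_z` off `o`, while `g` vanishes at `o`.
Pairing with `w g` bounds the Dirichlet form by `w z * g z`, and a single edge contributes at most
the whole sum. -/
lemma conductance_mul_sq_le (hS : S ∈ rowStochastic ℝ X) {w : X → ℝ} (hw : ∀ x, 0 < w x)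
    (hrev : ∀ x z, w x * S x z = w z * S z x) (hz : z ≠ o) (t : ℕ) (a b : X) :
    w a * S a b * (green S o z t a - green S o z t b) ^ 2 ≤ 2 * (w z * green S o z t z) := by
  set g := green S o z t with hg
  have hnn : ∀ x y, 0 ≤ w x * S x y * (g x - g y) ^ 2 := fun x y =>
    mul_nonneg (mul_nonneg (hw x).le (nonneg_of_mem_rowStochastic hS)) (sq_nonneg _)
  have hle : ∑ x, w x * g x * (g x - ∑ z, S x z * g z) ≤ w z * g z := by
    calc ∑ x, w x * g x * (g x - ∑ z, S x z * g z)
        ≤ ∑ x, w x * g x * (if x = z then 1 else 0) := by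
          refine Finset.sum_le_sum fun x _ => ?_
          rcases eq_or_ne x o with rfl | hx
          · rw [hg, green_self hz]; simp
          · refine mul_le_mul_of_nonneg_left ?_ (mul_nonneg (hw x).le (green_nonneg hS t x))
            have h := green_le_succ (o := o) (z := z) hS t x
            simp only [green, killed, if_neg hx] at h
            linarith
      _ = w z * g z := by simp
  rw [sum_mul_sub_eq_dirichlet hS hrev] at hle
  have h1 : w a * S a b * (g a - g b) ^ 2 ≤ ∑ x, ∑ z, w x * S x z * (g x - g z) ^ 2 :=
    (Finset.single_le_sum (f := fun y => w a * S a y * (g a - g y) ^ 2) (fun y _ => hnn a y)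
      (Finset.mem_univ b)).trans
      (Finset.single_le_sum (f := fun x => ∑ z, w x * S x z * (g x - g z) ^ 2)
        (fun x _ => Finset.sum_nonneg fun y _ => hnn x y) (Finset.mem_univ a))
  linarith

/-- The Green function is bounded by the resistance of a path to the killing state. -/
lemma green_le (hS : S ∈ rowStochastic ℝ X) {w : X → ℝ} (hw : ∀ x, 0 < w x)
    (hrev : ∀ x z, w x * S x z = w z * S z x) (hz : z ≠ o) {G : SimpleGraph X} (p : G.Walk z o)
    {L κ : ℝ} (hL : (p.length : ℝ) ≤ L) (hκ : 0 < κ)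
    (hp : ∀ a ∈ p.support, ∀ b ∈ p.support, G.Adj a b → κ ≤ w a * S a b) (t : ℕ) (x : X) :
    green S o z t x ≤ 2 * L ^ 2 * (w z / κ) := by
  refine (green_le_green_pole hS t x).trans ?_
  set γ := green S o z t z with hγ
  have hγ0 : 0 ≤ γ := green_nonneg hS t z
  set D := 2 * (w z * γ) / κ with hD
  have hD0 : 0 ≤ D := by have := (hw z).le; positivity
  -- Each edge of the path changes `g` by at most `√D`, and `g` vanishes at `o`. Hence `γ ≤ L √D`
  -- with `D` proportional to `γ`, and one factor `γ` cancels.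
  have hpath := abs_sub_le_length_mul (green S o z t) (s := √D) p fun a ha b hb hab => by
    refine Real.abs_le_sqrt ?_
    rw [hD, le_div_iff₀ hκ, mul_comm]
    exact (mul_le_mul_of_nonneg_right (hp a ha b hb hab) (sq_nonneg _)).trans
      (conductance_mul_sq_le hS hw hrev hz t a b)
  rw [green_self hz, sub_zero, ← hγ, abs_of_nonneg hγ0] at hpath
  have h1 : γ ^ 2 ≤ L ^ 2 * D := by
    calc γ ^ 2 ≤ (L * √D) ^ 2 := pow_le_pow_left₀ hγ0
          (hpath.trans (mul_le_mul_of_nonneg_right hL (Real.sqrt_nonneg _))) 2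
      _ = L ^ 2 * D := by rw [mul_pow, Real.sq_sqrt hD0]
  rcases hγ0.eq_or_lt with h0 | h0
  · rw [← h0]
    have := (hw z).le
    positivity
  · refine le_of_mul_le_mul_right ?_ h0
    calc γ * γ = γ ^ 2 := (sq γ).symm
      _ ≤ _ := h1
      _ = _ := by rw [hD]; ring

end Green

/-! ### Hitting the killing state -/

section Survival

variable {S : Matrix X X ℝ} {o : X}

lemma survival_nonneg (hS : S ∈ rowStochastic ℝ X) (t : ℕ) : ∀ x, 0 ≤ survival S o t x := by
  induction t with
  | zero => intro x; simp only [survival]; split_ifs <;> norm_num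
  | succ t ih => exact killed_nonneg hS o ih

lemma survival_succ_le (hS : S ∈ rowStochastic ℝ X) (t : ℕ) :
    ∀ x, survival S o (t + 1) x ≤ survival S o t x := by
  induction t with
  | zero =>
    intro x
    rcases eq_or_ne x o with rfl | hx
    · simp [survival, killed]
    · have := killed_le_of_le hS o (f := survival S o 0) zero_le_one
        (fun x => by simp only [survival]; split_ifs <;> norm_num) x
      simpa [survival, hx] using this
  | succ t ih => exact killed_mono hS o ih

/-- Both sides are the expected time spent off `o` before absorption, on the right split according
to the state visited. -/
lemma sum_survival_eq_sum_green (t : ℕ) :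
    ∀ x, ∑ s ∈ range t, survival S o s x = ∑ z ∈ univ.erase o, green S o z t x := by
  induction t with
  | zero => intro x; simp [green]
  | succ t ih =>
    intro x
    rw [Finset.sum_range_succ', show (fun s => survival S o (s + 1) x) =
      fun s => killed S o (survival S o s) x from rfl, ← killed_sum, funext ih, killed_sum]
    simp only [green, Finset.sum_add_distrib]
    rw [add_comm]
    congr 1
    by_cases h : x = o <;> simp [survival, h]

/-- Markov's inequality for the hitting time, using that survival decreases in `t`. -/
lemma mul_survival_le (hS : S ∈ rowStochastic ℝ X) {M : ℝ} {x : X} {t : ℕ}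
    (hM : ∑ s ∈ range t, survival S o s x ≤ M) : t * survival S o t x ≤ M := by
  refine le_trans ?_ hM
  have hanti : Antitone fun s => survival S o s x :=
    antitone_nat_of_succ_le fun s => survival_succ_le hS s x
  have := Finset.card_nsmul_le_sum (range t) (fun s => survival S o s x) (survival S o t x)
    fun s hs => hanti (Finset.mem_range.1 hs).le
  simpa [nsmul_eq_mul] using this

/-- Decomposition at the hitting time of `o`: the chain hits `o` by time `t` and is then back at `o`
after the remaining time with probability at least `c`. First-step induction replaces the strong
Markov property. -/
lemma pow_apply_ge_of_survival (hS : S ∈ rowStochastic ℝ X) {c : ℝ} (hc : 0 ≤ c)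
    (ho : ∀ s, c ≤ (S ^ s) o o) (t : ℕ) : ∀ x, c * (1 - survival S o t x) ≤ (S ^ t) x o := by
  have hoo : ∀ t, c * (1 - survival S o t o) ≤ (S ^ t) o o := fun t =>
    (mul_le_of_le_one_right hc (by linarith [survival_nonneg (o := o) hS t o])).trans (ho t)
  induction t with
  | zero =>
    intro x
    rcases eq_or_ne x o with rfl | hx
    · exact hoo 0
    · simp [survival, hx]
  | succ t ih =>
    intro x
    rcases eq_or_ne x o with rfl | hx
    · exact hoo (t + 1)
    · rw [pow_succ', Matrix.mul_apply]
      calc c * (1 - survival S o (t + 1) x)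
          = ∑ z, S x z * (c * (1 - survival S o t z)) := by
            simp only [survival, killed, if_neg hx, mul_sub, mul_one, Finset.sum_sub_distrib,
              ← Finset.sum_mul, sum_row_of_mem_rowStochastic hS, Finset.mul_sum, one_mul]
            congr 1
            exact Finset.sum_congr rfl fun z _ => by ring
        _ ≤ ∑ z, S x z * (S ^ t) z o := Finset.sum_le_sum fun z _ =>
            mul_le_mul_of_nonneg_left (ih z) (nonneg_of_mem_rowStochastic hS)

end Survival

/-! ### Return probabilities and the minorization -/

section Return

variable {S : Matrix X X ℝ} {o : X} {w : X → ℝ}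

lemma reversible_pow (hrev : ∀ x z, w x * S x z = w z * S z x) (t : ℕ) :
    ∀ x z, w x * (S ^ t) x z = w z * (S ^ t) z x := by
  induction t with
  | zero =>
    intro x z
    rcases eq_or_ne x z with rfl | h
    · rfl
    · simp [h, h.symm]
  | succ t ih =>
    intro x z
    rw [pow_succ, Matrix.mul_apply, ← pow_succ, pow_succ', Matrix.mul_apply, Finset.mul_sum,
      Finset.mul_sum]
    refine Finset.sum_congr rfl fun v _ => ?_
    rw [← mul_assoc, ih, mul_right_comm, hrev]
    ring

/-- For a reversible chain, the even-time return probability at a state of maximal weight is at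
least the reciprocal of the number of states. -/
lemma inv_card_le_return (hS : S ∈ rowStochastic ℝ X) (hw : ∀ x, 0 < w x)
    (hrev : ∀ x z, w x * S x z = w z * S z x) (ho : ∀ x, w x ≤ w o) (t : ℕ) :
    1 / (Fintype.card X : ℝ) ≤ (S ^ (2 * t)) o o := by
  have : Nonempty X := ⟨o⟩
  have hP := pow_mem hS t
  have hcard : (0 : ℝ) < Fintype.card X := by exact_mod_cast Fintype.card_pos
  rw [two_mul, pow_add, Matrix.mul_apply]
  -- Cauchy–Schwarz gives `1 ≤ n ∑ S^t(o,z)²`; maximality of `w o` and reversibility give `S^t(o,z)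
  -- ≤ S^t(z,o)`.
  have hcs := sq_sum_le_card_mul_sum_sq (s := univ) (f := fun z => (S ^ t) o z)
  rw [sum_row_of_mem_rowStochastic hP, one_pow, Finset.card_univ] at hcs
  rw [div_le_iff₀' hcard]
  refine hcs.trans (mul_le_mul_of_nonneg_left (Finset.sum_le_sum fun z _ => ?_) hcard.le)
  rw [sq]
  refine mul_le_mul_of_nonneg_left ?_ (nonneg_of_mem_rowStochastic hP)
  refine le_of_mul_le_mul_left ?_ (hw z)
  rw [← reversible_pow hrev t o z]
  exact mul_le_mul_of_nonneg_right (ho z) (nonneg_of_mem_rowStochastic hP)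

/-- The even-time bound says nothing about odd times, where a chain without holding might be
periodic. One holding step at `o`, of probability at least `θ`, corrects the parity. -/
lemma return_ge (hS : S ∈ rowStochastic ℝ X) (hw : ∀ x, 0 < w x)
    (hrev : ∀ x z, w x * S x z = w z * S z x) (ho : ∀ x, w x ≤ w o) {θ : ℝ} (hθ0 : 0 ≤ θ)
    (hθ : θ ≤ S o o) (s : ℕ) : θ / Fintype.card X ≤ (S ^ s) o o := by
  have hS1 : S o o ≤ 1 := le_one_of_mem_rowStochastic hS
  have hinv : (0 : ℝ) ≤ 1 / Fintype.card X := by positivity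
  obtain ⟨t, rfl | rfl⟩ := Nat.even_or_odd' s
  · refine le_trans ?_ (inv_card_le_return hS hw hrev ho t)
    rw [div_eq_mul_one_div]
    exact mul_le_of_le_one_left hinv (hθ.trans hS1)
  · rw [pow_succ', Matrix.mul_apply, div_eq_mul_one_div]
    refine (mul_le_mul hθ (inv_card_le_return hS hw hrev ho t) hinv (hθ0.trans hθ)).trans ?_
    exact Finset.single_le_sum (f := fun z => S o z * (S ^ (2 * t)) z o) (fun z _ =>
      mul_nonneg (nonneg_of_mem_rowStochastic hS) (nonneg_of_mem_rowStochastic (pow_mem hS _)))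
      (Finset.mem_univ o)

/-- A state of maximal weight is reached with probability bounded below after a time
proportional to the resistances of paths leading to it. -/
lemma minorization (hS : S ∈ rowStochastic ℝ X) (hw : ∀ x, 0 < w x)
    (hrev : ∀ x z, w x * S x z = w z * S z x) (ho : ∀ x, w x ≤ w o) {θ : ℝ} (hθ0 : 0 ≤ θ)
    (hθ : θ ≤ S o o) {G : SimpleGraph X} {r : ℝ}
    (hpath : ∀ z, ∃ p : G.Walk z o, ∃ κ, 0 < κ ∧ w z / κ ≤ r ∧
      ∀ a ∈ p.support, ∀ b ∈ p.support, G.Adj a b → κ ≤ w a * S a b)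
    {t : ℕ} (ht0 : 0 < t) (ht : 4 * (Fintype.card X : ℝ) ^ 3 * r ≤ t) (x : X) :
    θ / (2 * Fintype.card X) ≤ (S ^ t) x o := by
  have hc : 0 ≤ θ / Fintype.card X := by positivity
  refine le_trans ?_ (pow_apply_ge_of_survival hS hc (return_ge hS hw hrev ho hθ0 hθ) t x)
  have hr0 : 0 ≤ r := by
    obtain ⟨p, κ, hκ, hr, -⟩ := hpath o
    exact (div_pos (hw o) hκ).le.trans hr
  have hgreen : ∀ z ∈ univ.erase o, green S o z t x ≤ 2 * (Fintype.card X : ℝ) ^ 2 * r := by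
    intro z hz
    obtain ⟨p, κ, hκ, hr, hp⟩ := hpath z
    -- Shortcutting the walk to a path bounds its length by the number of states and keeps its
    -- support inside the old one.
    refine (green_le hS hw hrev (Finset.ne_of_mem_erase hz) (p.toPath : G.Walk z o)
      (L := Fintype.card X) ?_ hκ (fun a ha b hb hab => ?_) t x).trans ?_
    · exact_mod_cast (SimpleGraph.Walk.IsPath.length_lt p.toPath.2).le
    · exact hp a (p.support_toPath_subset_support ha) b (p.support_toPath_subset_support hb) hab
    · gcongr
  -- At most `n` Green functions, each at most `2 n² r`: this is why `t ≥ 4 n³ r` makes survival at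
  -- most `1/2`.
  have hM : ∑ s ∈ range t, survival S o s x ≤ t / 2 := by
    rw [sum_survival_eq_sum_green]
    refine (Finset.sum_le_card_nsmul _ _ _ hgreen).trans ?_
    rw [nsmul_eq_mul]
    have hcard : ((univ.erase o).card : ℝ) ≤ Fintype.card X := by
      exact_mod_cast Finset.card_le_univ _
    have : ((univ.erase o).card : ℝ) * (2 * (Fintype.card X : ℝ) ^ 2 * r) ≤
        Fintype.card X * (2 * (Fintype.card X : ℝ) ^ 2 * r) :=
      mul_le_mul_of_nonneg_right hcard (by positivity)
    nlinarith
  have ht' : (0 : ℝ) < t := by exact_mod_cast ht0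
  have hsurv : survival S o t x ≤ 1 / 2 := by
    refine le_of_mul_le_mul_left ?_ ht'
    linarith [mul_survival_le hS hM]
  calc θ / (2 * Fintype.card X) = θ / Fintype.card X * (1 / 2) := by ring
    _ ≤ _ := mul_le_mul_of_nonneg_left (by linarith) hc

end Return

end MarkovMatrix

/-! ### The graph of single spin flips -/

namespace ReplicatedSA

open Matrix Finset

variable {N y : ℕ}

lemma flip_apply (x : Config N y) (a : Fin y) (i : Fin N) (b : Fin y) (j : Fin N) :
    flip x a i b j = if b = a ∧ j = i then -(x b j) else x b j := by
  unfold flip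
  by_cases hb : b = a
  · subst hb
    by_cases hj : j = i
    · subst hj; simp
    · simp [hj]
  · simp [hb]

lemma eq_flip_comm {x z : Config N y} {a : Fin y} {i : Fin N} :
    z = flip x a i ↔ x = flip z a i := by
  constructor <;> rintro rfl <;> exact (flip_flip _ a i).symm

lemma flipGraph_preconnected (x z : Config N y) : (flipGraph N y).Reachable x z := by
  classical
  -- Interpolate between `x` and `z` by overwriting one coordinate at a time; each overwrite is
  -- trivial or a flip.
  have key : ∀ s : Finset (Fin y × Fin N),
      (flipGraph N y).Reachable x (fun a i => if (a, i) ∈ s then z a i else x a i) := by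
    intro s
    induction s using Finset.induction_on with
    | empty => simp
    | insert q s hq ih =>
      obtain ⟨a, i⟩ := q
      refine ih.trans ?_
      by_cases h : z a i = x a i
      · refine SimpleGraph.Reachable.refl _ |>.trans (Eq.subst (motive := fun v =>
          (flipGraph N y).Reachable _ v) ?_ (SimpleGraph.Reachable.refl _))
        ext b j
        by_cases hbj : (b, j) = (a, i)
        · obtain ⟨rfl, rfl⟩ := Prod.mk.inj hbj
          simp [hq, h]
        · simp [Finset.mem_insert, hbj]
      · refine SimpleGraph.Adj.reachable ⟨a, i, ?_⟩
        funext b j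
        rw [flip_apply]
        by_cases hbj : (b, j) = (a, i)
        · obtain ⟨rfl, rfl⟩ := Prod.mk.inj hbj
          simpa [hq] using Int.units_ne_iff_eq_neg.1 h
        · have : ¬(b = a ∧ j = i) := fun h => hbj (by rw [h.1, h.2])
          simp [Finset.mem_insert, hbj, this]
  simpa using key Finset.univ

/-! ### The critical height -/

section Barrier

variable (F : Config N y → ℝ)

lemma le_elevation {x z : Config N y} (p : (flipGraph N y).Walk x z) {v : Config N y}
    (hv : v ∈ p.support) : F v ≤ elevation F p :=
  le_csSup (Set.toFinite _).bddAbove ⟨v, hv, rfl⟩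

/-- There may be infinitely many walks, but their elevations are values of `F`, so the infimum is
attained. -/
lemma exists_walk_elevation_eq (x z : Config N y) :
    ∃ p : (flipGraph N y).Walk x z, elevation F p = commHeight F x z := by
  have hne : Nonempty ((flipGraph N y).Walk x z) := flipGraph_preconnected x z
  have hfin : (Set.range fun p : (flipGraph N y).Walk x z => elevation F p).Finite := by
    refine (Set.finite_range F).subset ?_
    rintro _ ⟨p, rfl⟩
    obtain ⟨v, -, hv⟩ := Set.Nonempty.csSup_mem (s := F '' {w | w ∈ p.support})
      ⟨_, x, p.start_mem_support, rfl⟩ (Set.toFinite _)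
    exact ⟨v, hv⟩
  exact (Set.range_nonempty _).csInf_mem hfin

lemma le_barrier (x z : Config N y) :
    commHeight F x z - F x - F z + ⨅ v, F v ≤ barrier F :=
  add_le_add_left (le_ciSup (f := fun q : Config N y × Config N y =>
    commHeight F q.1 q.2 - F q.1 - F q.2) (Set.finite_range _).bddAbove (x, z)) _

lemma barrier_nonneg : 0 ≤ barrier F := by
  obtain ⟨x, hx⟩ := exists_eq_ciInf_of_finite (f := F)
  obtain ⟨p, hp⟩ := exists_walk_elevation_eq F x x
  have h1 := le_elevation F p p.start_mem_support
  have h2 := le_barrier F x x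
  linarith

/-- At a minimizer `o` the terms `-F o` and `+ min F` in the barrier cancel. -/
lemma elevation_sub_le_barrier {o : Config N y} (ho : ∀ x, F o ≤ F x) (z : Config N y) :
    ∃ p : (flipGraph N y).Walk z o, elevation F p - F z ≤ barrier F := by
  obtain ⟨p, hp⟩ := exists_walk_elevation_eq F z o
  have h1 : F o ≤ ⨅ v, F v := le_ciInf ho
  have h2 := le_barrier F z o
  exact ⟨p, by linarith⟩

end Barrier

lemma critHeight_nonneg (E : Spins N → ℝ) (β γ : ℝ) : 0 ≤ critHeight y E β γ :=
  barrier_nonneg _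

/-! ### The proposal chain and the Metropolis matrix -/

lemma proposal_nonneg (x z : Config N y) : 0 ≤ proposal x z := by
  unfold proposal
  refine div_nonneg (Finset.sum_nonneg fun a _ => Finset.sum_nonneg fun i _ => ?_) (by positivity)
  split_ifs <;> norm_num

lemma proposal_comm (x z : Config N y) : proposal x z = proposal z x := by
  unfold proposal
  simp_rw [eq_flip_comm (x := x) (z := z)]

lemma proposal_eq_zero {x z : Config N y} (h : ∀ a i, z ≠ flip x a i) : proposal x z = 0 := by
  simp [proposal, h]

lemma inv_le_proposal (x : Config N y) (a : Fin y) (i : Fin N) :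
    1 / ((N : ℝ) * y) ≤ proposal x (flip x a i) := by
  unfold proposal
  refine div_le_div_of_nonneg_right ?_ (by positivity)
  have hnn : ∀ b j, (0 : ℝ) ≤ if flip x a i = flip x b j then 1 else 0 := fun b j => by
    split_ifs <;> norm_num
  calc (1 : ℝ) = if flip x a i = flip x a i then 1 else 0 := by simp
    _ ≤ ∑ j, if flip x a i = flip x a j then (1 : ℝ) else 0 :=
        Finset.single_le_sum (f := fun j => if flip x a i = flip x a j then (1 : ℝ) else 0)
          (fun j _ => hnn a j) (Finset.mem_univ i)
    _ ≤ _ := Finset.single_le_sum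
        (f := fun b => ∑ j, if flip x a i = flip x b j then (1 : ℝ) else 0)
          (fun b _ => Finset.sum_nonneg fun j _ => hnn b j) (Finset.mem_univ a)

lemma sum_proposal (hN : 1 ≤ N) (hy : 1 ≤ y) (x : Config N y) : ∑ z, proposal x z = 1 := by
  unfold proposal
  have hN' : (N : ℝ) ≠ 0 := by positivity
  have hy' : (y : ℝ) ≠ 0 := by positivity
  rw [← Finset.sum_div, Finset.sum_comm]
  simp_rw [Finset.sum_comm (s := (univ : Finset (Config N y)))]
  simp only [Finset.sum_ite_eq', Finset.mem_univ, if_true, Finset.sum_const, Finset.card_univ,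
    Fintype.card_fin, nsmul_eq_mul, mul_one]
  field_simp

section Metropolis

variable (E : Spins N → ℝ) {β : ℝ} (γ : ℝ)

lemma metropolis_of_ne (β : ℝ) {x z : Config N y} (h : x ≠ z) : metropolis E β γ x z =
    Real.exp (-β * max (energy E β γ z - energy E β γ x) 0) * proposal x z := by
  simp [metropolis, h]

lemma metropolis_self (β : ℝ) (x : Config N y) : metropolis E β γ x x =
    1 - ∑ w ∈ univ.erase x,
      Real.exp (-β * max (energy E β γ w - energy E β γ x) 0) * proposal x w := by
  simp [metropolis]

/-- If all proposed moves from `x` are accepted with probability at most `e`, then the chain stays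
at `x` with probability at least `1 - e`. -/
lemma le_metropolis_self (hN : 1 ≤ N) (hy : 1 ≤ y) (x : Config N y) {e : ℝ} (he : 0 ≤ e)
    (h : ∀ a i, Real.exp (-β * max (energy E β γ (flip x a i) - energy E β γ x) 0) ≤ e) :
    1 - e ≤ metropolis E β γ x x := by
  rw [metropolis_self]
  refine sub_le_sub_left ?_ 1
  calc _ ≤ ∑ w ∈ univ.erase x, e * proposal x w := by
        refine Finset.sum_le_sum fun w _ => ?_
        by_cases hw : ∃ a i, w = flip x a i
        · obtain ⟨a, i, rfl⟩ := hw
          exact mul_le_mul_of_nonneg_right (h a i) (proposal_nonneg _ _)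
        · push Not at hw
          simp [proposal_eq_zero hw]
    _ ≤ ∑ w, e * proposal x w := Finset.sum_le_sum_of_subset_of_nonneg (Finset.erase_subset _ _)
        fun w _ _ => mul_nonneg he (proposal_nonneg _ _)
    _ = e := by rw [← Finset.mul_sum, sum_proposal hN hy, mul_one]

lemma metropolis_mem_rowStochastic (hN : 1 ≤ N) (hy : 1 ≤ y) (hβ : 0 ≤ β) :
    (metropolis E β γ : Matrix (Config N y) (Config N y) ℝ) ∈ rowStochastic ℝ (Config N y) := by
  rw [mem_rowStochastic_iff_sum]
  refine ⟨fun x z => ?_, fun x => ?_⟩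
  · rcases eq_or_ne x z with rfl | h
    · have := le_metropolis_self E γ (β := β) hN hy x zero_le_one fun a i =>
        Real.exp_le_one_iff.2 (by
          have : 0 ≤ max (energy E β γ (flip x a i) - energy E β γ x) 0 := le_max_right _ _
          nlinarith)
      linarith
    · rw [metropolis_of_ne E γ β h]
      exact mul_nonneg (Real.exp_pos _).le (proposal_nonneg _ _)
  · rw [← Finset.add_sum_erase _ _ (Finset.mem_univ x), metropolis_self]
    rw [Finset.sum_congr rfl fun z hz =>
      metropolis_of_ne E γ β (Finset.ne_of_mem_erase hz).symm]
    ring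

lemma exp_mul_metropolis (β : ℝ) {x z : Config N y} (h : x ≠ z) :
    Real.exp (-β * energy E β γ x) * metropolis E β γ x z =
      Real.exp (-(β * max (energy E β γ x) (energy E β γ z))) * proposal x z := by
  rw [metropolis_of_ne E γ β h, ← mul_assoc, ← Real.exp_add]
  congr 2
  rw [← mul_add, neg_mul, add_comm, max_add, sub_add_cancel, zero_add, max_comm]

lemma metropolis_reversible (β : ℝ) (x z : Config N y) :
    Real.exp (-β * energy E β γ x) * metropolis E β γ x z =
      Real.exp (-β * energy E β γ z) * metropolis E β γ z x := by
  rcases eq_or_ne x z with rfl | h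
  · rfl
  · rw [exp_mul_metropolis E γ β h, exp_mul_metropolis E γ β h.symm, max_comm, proposal_comm]

lemma exists_walk_conductance (hN : 1 ≤ N) (hy : 1 ≤ y) (hβ : 0 < β) {o : Config N y}
    (ho : ∀ x : Config N y, energy E β γ o ≤ energy E β γ x) (z : Config N y) :
    ∃ p : (flipGraph N y).Walk z o, ∃ κ : ℝ, 0 < κ ∧
      Real.exp (-β * energy E β γ z) / κ ≤ N * y * Real.exp (β * critHeight y E β γ) ∧
      ∀ a ∈ p.support, ∀ b ∈ p.support, (flipGraph N y).Adj a b →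
        κ ≤ Real.exp (-β * energy E β γ a) * metropolis E β γ a b := by
  have hN' : (0 : ℝ) < N := by positivity
  have hy' : (0 : ℝ) < y := by positivity
  obtain ⟨p, hp⟩ := elevation_sub_le_barrier (energy E β γ) ho z
  -- The conductance of an edge is `e^{-β max F}` over its endpoints times the proposal probability,
  -- so the elevation of `p` and `1 / (N y)` bound it below along all of `p`.
  refine ⟨p, Real.exp (-(β * elevation (energy E β γ) p)) * (1 / (N * y)), by positivity, ?_, ?_⟩
  · rw [div_le_iff₀ (by positivity)]
    have h1 : N * y * Real.exp (β * critHeight y E β γ) *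
        (Real.exp (-(β * elevation (energy E β γ) p)) * (1 / (N * y))) =
        Real.exp (β * critHeight y E β γ + -(β * elevation (energy E β γ) p)) := by
      rw [Real.exp_add]
      field_simp
    rw [h1]
    refine Real.exp_le_exp.2 ?_
    have h2 := mul_le_mul_of_nonneg_left hp hβ.le
    have h3 : critHeight y E β γ = barrier (energy E β γ : Config N y → ℝ) := rfl
    rw [h3]
    linarith
  · intro a ha b hb hab
    rw [exp_mul_metropolis E γ β hab.ne]
    refine mul_le_mul ?_ ?_ (by positivity) (Real.exp_pos _).le
    · refine Real.exp_le_exp.2 (neg_le_neg (mul_le_mul_of_nonneg_left ?_ hβ.le))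
      exact max_le (le_elevation _ p ha) (le_elevation _ p hb)
    · obtain ⟨c, i, rfl⟩ := hab
      exact inv_le_proposal a c i

end Metropolis

/-! ### The coupling -/

section Coupling

lemma log_cosh_le_log_cosh {s t : ℝ} (h : |s| ≤ |t|) :
    Real.log (Real.cosh s) ≤ Real.log (Real.cosh t) :=
  Real.log_le_log (Real.cosh_pos s) (Real.cosh_le_cosh.2 h)

/-- The gap between the values of `log cosh (γ ·)` at two points grows with `γ`. -/
lemma log_cosh_sub_le {γ γ' s Y : ℝ} (hγ : 0 ≤ γ) (hγ' : γ ≤ γ') (hs : |s| ≤ Y) :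
    Real.log (Real.cosh (γ * Y)) - Real.log (Real.cosh (γ * s)) ≤
      Real.log (Real.cosh (γ' * Y)) - Real.log (Real.cosh (γ' * s)) := by
  obtain ⟨h1, h2⟩ := abs_le.1 hs
  have hcc : ∀ a b : ℝ, 2 * (Real.cosh a * Real.cosh b) = Real.cosh (a + b) + Real.cosh (a - b) :=
    fun a b => by rw [Real.cosh_add, Real.cosh_sub]; ring
  have hp : Real.cosh (γ * Y + γ' * s) ≤ Real.cosh (γ' * Y + γ * s) := by
    refine Real.cosh_le_cosh.2 (abs_le.2 ?_ |>.trans (le_abs_self _))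
    constructor <;> nlinarith
  have hm : Real.cosh (γ * Y - γ' * s) ≤ Real.cosh (γ' * Y - γ * s) := by
    refine Real.cosh_le_cosh.2 (abs_le.2 ?_ |>.trans (le_abs_self _))
    constructor <;> nlinarith
  -- In product form the claim follows termwise from the product-to-sum formula.
  have hmul : Real.cosh (γ * Y) * Real.cosh (γ' * s) ≤ Real.cosh (γ' * Y) * Real.cosh (γ * s) := by
    linarith [hcc (γ * Y) (γ' * s), hcc (γ' * Y) (γ * s)]
  have hlog := Real.log_le_log (mul_pos (Real.cosh_pos _) (Real.cosh_pos _)) hmul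
  rw [Real.log_mul (Real.cosh_pos _).ne' (Real.cosh_pos _).ne',
    Real.log_mul (Real.cosh_pos _).ne' (Real.cosh_pos _).ne'] at hlog
  linarith

lemma couplingGap_mono (hy : 1 ≤ y) {γ γ' : ℝ} (hγ : 0 ≤ γ) (hγ' : γ ≤ γ') :
    couplingGap y γ ≤ couplingGap y γ' := by
  have : (1 : ℝ) ≤ y := by exact_mod_cast hy
  exact log_cosh_sub_le hγ hγ' (abs_le.2 ⟨by linarith, by linarith⟩)

lemma couplingGap_pos (hy : 2 ≤ y) {γ : ℝ} (hγ : 0 < γ) : 0 < couplingGap y γ := by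
  have : (2 : ℝ) ≤ y := by exact_mod_cast hy
  refine sub_pos.2 (Real.log_lt_log (Real.cosh_pos _) (Real.cosh_lt_cosh.2 ?_))
  rw [abs_mul, abs_mul, abs_of_nonneg (by linarith : (0 : ℝ) ≤ y - 2),
    abs_of_nonneg (by linarith : (0 : ℝ) ≤ y)]
  exact mul_lt_mul_of_pos_left (by linarith) (abs_pos.2 hγ.ne')

lemma abs_unit (u : ℤˣ) : |((u : ℤ) : ℝ)| = 1 := by
  rcases Int.units_eq_one_or u with rfl | rfl <;> simp

lemma abs_sum_spin_le (x : Config N y) (i : Fin N) : |∑ a, ((x a i : ℤ) : ℝ)| ≤ y := by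
  refine (Finset.abs_sum_le_sum_abs _ _).trans ?_
  simp [abs_unit]

lemma coupling_const (γ : ℝ) (σ : Spins N) :
    coupling γ (fun _ : Fin y => σ) = N * Real.log (Real.cosh (γ * y)) := by
  unfold coupling
  have h : ∀ i, Real.cosh (γ * ∑ _a : Fin y, ((σ i : ℤ) : ℝ)) = Real.cosh (γ * y) := fun i => by
    rcases Int.units_eq_one_or (σ i) with h | h <;> simp [h]
  simp_rw [h]
  simp

lemma coupling_le (γ : ℝ) (x : Config N y) :
    coupling γ x ≤ N * Real.log (Real.cosh (γ * y)) := by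
  rw [← coupling_const γ (fun _ : Fin N => 1)]
  unfold coupling
  refine Finset.sum_le_sum fun i _ => log_cosh_le_log_cosh ?_
  rw [abs_mul, abs_mul]
  refine mul_le_mul_of_nonneg_left ?_ (abs_nonneg _)
  simpa using abs_sum_spin_le x i

/-- The distance of the coupling to its maximum grows with `γ`. -/
lemma coupling_sub_le (x : Config N y) {γ γ' : ℝ} (hγ : 0 ≤ γ) (hγ' : γ ≤ γ') :
    N * Real.log (Real.cosh (γ * y)) - coupling γ x ≤
      N * Real.log (Real.cosh (γ' * y)) - coupling γ' x := by
  have h : ∀ γ, N * Real.log (Real.cosh (γ * y)) - coupling γ x =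
      ∑ i : Fin N, (Real.log (Real.cosh (γ * y)) -
        Real.log (Real.cosh (γ * ∑ a : Fin y, ((x a i : ℤ) : ℝ)))) := fun γ => by
    simp [coupling, Finset.sum_sub_distrib]
  rw [h, h]
  exact Finset.sum_le_sum fun i _ => log_cosh_sub_le hγ hγ' (abs_sum_spin_le x i)

lemma sum_flip (x : Config N y) (a : Fin y) (i j : Fin N) :
    ∑ b, ((flip x a i b j : ℤ) : ℝ) =
      ∑ b, ((x b j : ℤ) : ℝ) - if j = i then 2 * ((x a i : ℤ) : ℝ) else 0 := by
  by_cases hj : j = i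
  · subst hj
    rw [← Finset.add_sum_erase _ _ (Finset.mem_univ a),
      ← Finset.add_sum_erase _ (fun b => ((x b j : ℤ) : ℝ)) (Finset.mem_univ a),
      Finset.sum_congr rfl fun b hb => by
        rw [flip_apply, if_neg fun h => Finset.ne_of_mem_erase hb h.1]]
    simp [flip_apply]
    ring
  · simp [flip_apply, hj]

lemma coupling_flip_const (γ : ℝ) (σ : Spins N) (a : Fin y) (i : Fin N) :
    coupling γ (flip (fun _ : Fin y => σ) a i) =
      coupling γ (fun _ : Fin y => σ) - couplingGap y γ := by
  have hrest : ∀ j ∈ univ.erase i,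
      Real.log (Real.cosh (γ * ∑ b, ((flip (fun _ : Fin y => σ) a i b j : ℤ) : ℝ))) =
      Real.log (Real.cosh (γ * ∑ b : Fin y, ((σ j : ℤ) : ℝ))) := fun j hj => by
    rw [sum_flip, if_neg (Finset.ne_of_mem_erase hj), sub_zero]
  unfold coupling
  rw [← Finset.add_sum_erase _ _ (Finset.mem_univ i), Finset.sum_congr rfl hrest,
    ← Finset.add_sum_erase _ (fun j => Real.log (Real.cosh (γ * ∑ b : Fin y, ((σ j : ℤ) : ℝ))))
      (Finset.mem_univ i), sum_flip]
  unfold couplingGap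
  rcases Int.units_eq_one_or (σ i) with h | h
  · simp [h]
    ring
  · have : γ * (-(y : ℝ) + 2) = -(γ * (y - 2)) := by ring
    simp [h, this]
    ring

end Coupling

/-! ### Contraction of the Metropolis chain -/

section Contraction

variable {E : Spins N → ℝ}

lemma totalEnergy_nonneg (hE : ∀ σ, 0 ≤ E σ) (x : Config N y) : 0 ≤ totalEnergy E x :=
  Finset.sum_nonneg fun _ _ => hE _

lemma totalEnergy_const {σ : Spins N} (hσ : E σ = 0) :
    totalEnergy E (fun _ : Fin y => σ) = 0 := by
  simp [totalEnergy, hσ]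

lemma energy_const_le (hE : ∀ σ, 0 ≤ E σ) {σ : Spins N} (hσ : E σ = 0) {β : ℝ} (hβ : 0 < β)
    (γ : ℝ) (x : Config N y) : energy E β γ (fun _ : Fin y => σ) ≤ energy E β γ x := by
  unfold energy
  rw [totalEnergy_const hσ, coupling_const]
  have h1 := div_le_div_of_nonneg_right (coupling_le γ x) hβ.le
  have h2 := totalEnergy_nonneg hE x
  linarith

lemma couplingGap_le_energy_flip (hE : ∀ σ, 0 ≤ E σ) {σ : Spins N} (hσ : E σ = 0) {β : ℝ}
    (hβ : 0 < β) (γ : ℝ) (a : Fin y) (i : Fin N) :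
    couplingGap y γ ≤
      β * (energy E β γ (flip (fun _ : Fin y => σ) a i) - energy E β γ fun _ : Fin y => σ) := by
  unfold energy
  rw [totalEnergy_const hσ, coupling_flip_const]
  have h2 := mul_nonneg hβ.le (totalEnergy_nonneg hE (flip (fun _ : Fin y => σ) a i))
  field_simp
  linarith

theorem exists_isContractionPair (hN : 1 ≤ N) (hy : 2 ≤ y) (hE : ∀ σ, 0 ≤ E σ)
    (hmin : ∃ σ, E σ = 0) {γ₀ : ℝ} (hγ₀ : 0 < γ₀) :
    ∃ C κ₃ : ℝ, C ≤ 1 - Real.exp (-1) ∧ IsContractionPair y E γ₀ C κ₃ := by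
  obtain ⟨σ, hσ⟩ := hmin
  have hy1 : 1 ≤ y := by omega
  set n : ℝ := (Fintype.card (Config N y) : ℝ) with hn
  have hn1 : 1 ≤ n := by
    rw [hn]
    exact_mod_cast Nat.one_le_iff_ne_zero.2 Fintype.card_ne_zero
  -- `A e^{βm}` is the time demanded by the minorization when the resistance bound is `N y e^{βm}`.
  set A : ℝ := 4 * n ^ 3 * (N * y) with hA
  have hNy : (1 : ℝ) ≤ N * y := by exact_mod_cast Nat.mul_pos hN hy1
  have hA1 : 1 ≤ A := by nlinarith [one_le_pow₀ hn1 (n := 3)]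
  set e := Real.exp (-couplingGap y γ₀) with he
  have he0 : 0 < e := Real.exp_pos _
  have he1 : e < 1 := Real.exp_lt_one_iff.2 (neg_lt_zero.2 (couplingGap_pos hy hγ₀))
  set c := (1 - e) / (2 * n) with hc
  have hc0 : 0 < c := div_pos (by linarith) (by linarith)
  have hc1 : c ≤ 1 / 2 := by
    rw [hc, div_le_div_iff₀ (by linarith) (by norm_num)]
    linarith
  have hC : c / (2 * A) ≤ 1 / 4 := by
    rw [div_le_div_iff₀ (by linarith) (by norm_num)]
    linarith
  -- The factor `2` in `C` absorbs the rounding of `τ`: as `A B ≥ 1`, `τ ≤ 2 A B`, so `τ C / B ≤ c`.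
  refine ⟨c / (2 * A), n / (1 - c), ?_, by positivity, by linarith,
    div_pos (by linarith) (by linarith), fun β γ hβ hγ T ρ hρ => ?_⟩
  · linarith [Real.exp_neg_one_lt_d9]
  set B := Real.exp (β * critHeight y E β γ) with hB
  have hB1 : 1 ≤ B := Real.one_le_exp (mul_nonneg hβ.le (critHeight_nonneg E β γ))
  have hBinv : Real.exp (-β * critHeight y E β γ) = B⁻¹ := by rw [neg_mul, Real.exp_neg]
  have hAB : 1 ≤ A * B := one_le_mul_of_one_le_of_one_le hA1 hB1
  set τ := ⌈A * B⌉₊ with hτ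
  have hτ0 : 0 < τ := Nat.ceil_pos.2 (by linarith)
  have hτ2 : (τ : ℝ) ≤ 2 * (A * B) := by linarith [Nat.ceil_lt_add_one (by linarith : 0 ≤ A * B)]
  -- Every flip out of the ground state is accepted with probability at most `e^{-B'(γ)}`, and `B'`
  -- is monotone; this makes the bound uniform in `β` and in `γ ≥ γ₀`.
  have hhold : 1 - e ≤ metropolis E β γ (fun _ : Fin y => σ) (fun _ : Fin y => σ) := by
    refine le_metropolis_self E γ hN hy1 _ he0.le fun a i => Real.exp_le_exp.2 ?_
    have h1 := couplingGap_le_energy_flip hE hσ hβ γ a i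
    have h2 := couplingGap_mono hy1 hγ₀.le hγ
    have h3 := mul_le_mul_of_nonneg_left (le_max_left
      (energy E β γ (flip (fun _ : Fin y => σ) a i) - energy E β γ fun _ : Fin y => σ) 0) hβ.le
    linarith
  have hS := metropolis_mem_rowStochastic (y := y) E γ hN hy1 hβ.le
  have hminor := MarkovMatrix.minorization hS (w := fun x => Real.exp (-β * energy E β γ x))
    (fun x => Real.exp_pos _) (metropolis_reversible E γ β)
    (fun x => Real.exp_le_exp.2 (by
      have := mul_le_mul_of_nonneg_left (energy_const_le hE hσ hβ γ x) hβ.le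
      linarith)) (by linarith) hhold
    (exists_walk_conductance E γ hN hy1 hβ (energy_const_le hE hσ hβ γ)) hτ0 (by
      refine le_trans (le_of_eq ?_) (Nat.le_ceil (A * B))
      rw [hA]
      ring)
  rw [hBinv]
  refine MarkovMatrix.norm_vecMul_pow_le hS hτ0 hminor (by linarith) (by positivity) ?_ ?_ hρ T
  · exact mul_le_one₀ (by linarith) (by positivity) (inv_le_one_of_one_le₀ hB1)
  · calc τ * (c / (2 * A) * B⁻¹) ≤ 2 * (A * B) * (c / (2 * A) * B⁻¹) :=
          mul_le_mul_of_nonneg_right hτ2 (by positivity)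
      _ = c := by field_simp

end Contraction

end ReplicatedSA

/-! ### Inhomogeneous evolution with summable perturbations -/

namespace MarkovMatrix

open Matrix Finset

variable {X : Type*} [Fintype X] [DecidableEq X]

lemma vecMul_eq_of_reversible {S : Matrix X X ℝ} (hS : S ∈ rowStochastic ℝ X) {w : X → ℝ}
    (hrev : ∀ x z, w x * S x z = w z * S z x) : w ᵥ* S = w := by
  ext z
  simp only [vecMul, dotProduct, hrev _ z]
  rw [← Finset.mul_sum, sum_row_of_mem_rowStochastic hS, mul_one]

/-- A perturbed inhomogeneous Markov evolution of signed measures of mass zero tends to zero if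
the evolution contracts and the perturbations are summable in `ℓ¹`. -/
lemma tendsto_zero_of_contraction {P : ℕ → Matrix X X ℝ} (hP : ∀ n, P n ∈ rowStochastic ℝ X)
    {u : ℕ → ℝ} (hu : ∀ n, 0 < u n) (hu0 : Filter.Tendsto u Filter.atTop (nhds 0))
    (hcontr : ∀ (n : ℕ) (ρ : X → ℝ), ∑ x, ρ x = 0 →
      ‖ρ ᵥ* P (n + 1)‖ * u n ≤ u (n + 1) * ‖ρ‖)
    {d e : ℕ → X → ℝ} {z : ℕ → ℝ} {l : ℝ} (hd0 : ∀ n, ∑ x, d n x = 0)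
    (hd : ∀ n, d (n + 1) = (d n + e n) ᵥ* P (n + 1))
    (he : ∀ n, ∑ x, |e n x| ≤ z n - z (n + 1)) (hz : Filter.Tendsto z Filter.atTop (nhds l)) :
    Filter.Tendsto d Filter.atTop (nhds 0) := by
  have hanti : Antitone z := antitone_nat_of_succ_le fun n => by
    have := (Finset.sum_nonneg fun x _ => abs_nonneg (e n x)).trans (he n)
    linarith
  have hl : ∀ n, l ≤ z n := fun n => hanti.le_of_tendsto hz n
  rw [tendsto_zero_iff_norm_tendsto_zero, Metric.tendsto_atTop]
  intro ε hε
  obtain ⟨K, hK⟩ := (hz.eventually_lt_const (show l < l + ε / 2 by linarith)).exists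
  -- `ρ` is the unperturbed evolution restarted from `d K`. It decays like `u`, while its distance
  -- to `d` is at most the perturbation after time `K`. That distance is measured in `ℓ¹`, where
  -- stochastic matrices do not expand.
  set ρ : ℕ → X → ℝ := fun j => Nat.rec (d K) (fun j r => r ᵥ* P (K + j + 1)) j with hρ
  have hρs : ∀ j, ρ (j + 1) = ρ j ᵥ* P (K + j + 1) := fun j => rfl
  have hρ0 : ∀ j, ∑ x, ρ j x = 0 := fun j => by
    induction j with
    | zero => exact hd0 K
    | succ j ih => rw [hρs, sum_vecMul (hP _), ih]
  have hρu : ∀ j, ‖ρ j‖ * u K ≤ u (K + j) * ‖d K‖ := fun j => by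
    induction j with
    | zero => exact (mul_comm _ _).le
    | succ j ih =>
      refine le_of_mul_le_mul_right ?_ (hu (K + j))
      calc ‖ρ (j + 1)‖ * u K * u (K + j) = (‖ρ j ᵥ* P (K + j + 1)‖ * u (K + j)) * u K := by
            rw [hρs]; ring
        _ ≤ (u (K + j + 1) * ‖ρ j‖) * u K :=
            mul_le_mul_of_nonneg_right (hcontr _ _ (hρ0 j)) (hu K).le
        _ = u (K + j + 1) * (‖ρ j‖ * u K) := by ring
        _ ≤ u (K + j + 1) * (u (K + j) * ‖d K‖) :=
            mul_le_mul_of_nonneg_left ih (hu _).le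
        _ = u (K + (j + 1)) * ‖d K‖ * u (K + j) := by rw [add_assoc]; ring
  have hdiff : ∀ j, ∑ x, |(d (K + j) - ρ j) x| ≤ z K - z (K + j) := fun j => by
    induction j with
    | zero => simp [hρ]
    | succ j ih =>
      have : d (K + (j + 1)) - ρ (j + 1) = (d (K + j) - ρ j + e (K + j)) ᵥ* P (K + j + 1) := by
        rw [← add_assoc, hd, hρs, ← sub_vecMul]
        congr 1
        abel
      rw [this]
      refine (sum_abs_vecMul_le_of_mem (hP _) _).trans ?_
      have h1 : ∑ x, |(d (K + j) - ρ j + e (K + j)) x| ≤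
          ∑ x, |(d (K + j) - ρ j) x| + ∑ x, |e (K + j) x| := by
        rw [← Finset.sum_add_distrib]
        exact Finset.sum_le_sum fun x _ => abs_add_le _ _
      have h2 := he (K + j)
      rw [← add_assoc]
      linarith
  have hlim : Filter.Tendsto (fun n => u n * ‖d K‖) Filter.atTop (nhds 0) := by
    simpa using hu0.mul_const ‖d K‖
  obtain ⟨M, hM⟩ := Filter.eventually_atTop.1
    (hlim.eventually_lt_const (show 0 < ε / 2 * u K from mul_pos (by linarith) (hu K)))
  refine ⟨max K M, fun n hn => ?_⟩
  obtain ⟨j, rfl⟩ := Nat.exists_eq_add_of_le ((le_max_left K M).trans hn)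
  have h1 : ‖ρ j‖ < ε / 2 := lt_of_mul_lt_mul_right
    ((hρu j).trans_lt (hM _ ((le_max_right K M).trans hn))) (hu K).le
  have h2 := (norm_le_sum_abs _).trans (hdiff j)
  have h3 : ‖d (K + j)‖ ≤ ‖d (K + j) - ρ j‖ + ‖ρ j‖ := by
    simpa using norm_add_le (d (K + j) - ρ j) (ρ j)
  rw [Real.dist_eq, sub_zero, abs_of_nonneg (norm_nonneg _)]
  linarith [hl (K + j)]

end MarkovMatrix

namespace ReplicatedSA

open Matrix Finset

variable {N y : ℕ}

/-! ### The measures `Qbar` -/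

/-- The weights of `Qbar`, normalized so that ground states have weight one. -/
def weight (E : Spins N → ℝ) (β γ : ℝ) (x : Config N y) : ℝ :=
  Real.exp (-β * totalEnergy E x + coupling γ x - N * Real.log (Real.cosh (γ * y)))

section Weight

variable {E : Spins N → ℝ}

lemma weight_pos (E : Spins N → ℝ) (β γ : ℝ) (x : Config N y) : 0 < weight E β γ x :=
  Real.exp_pos _

lemma Qbar_eq_weight_div (E : Spins N → ℝ) (β γ : ℝ) (x : Config N y) :
    Qbar E β γ x = weight E β γ x / ∑ z : Config N y, weight E β γ z := by
  unfold Qbar weight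
  simp_rw [Real.exp_sub]
  rw [← Finset.sum_div, div_div_div_cancel_right₀ (Real.exp_pos _).ne']

/-- The exponent is `-β ∑ E` minus the distance of the coupling from its maximum; the energy is
nonnegative and that distance grows with `γ`. -/
lemma weight_anti (hE : ∀ σ, 0 ≤ E σ) {β β' γ γ' : ℝ} (hβ : β ≤ β') (hγ0 : 0 ≤ γ) (hγ : γ ≤ γ')
    (x : Config N y) : weight E β' γ' x ≤ weight E β γ x := by
  refine Real.exp_le_exp.2 ?_
  have h1 := coupling_sub_le x hγ0 hγ
  have h2 := mul_le_mul_of_nonneg_right hβ (totalEnergy_nonneg hE x)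
  linarith

lemma one_le_sum_weight {σ : Spins N} (hσ : E σ = 0) (β γ : ℝ) :
    1 ≤ ∑ x : Config N y, weight E β γ x := by
  have h : weight E β γ (fun _ : Fin y => σ) = 1 := by
    simp [weight, totalEnergy_const hσ, coupling_const]
  rw [← h]
  exact Finset.single_le_sum (fun x _ => (weight_pos E β γ x).le) (Finset.mem_univ _)

lemma sum_Qbar (hmin : ∃ σ, E σ = 0) (β γ : ℝ) : ∑ x : Config N y, Qbar E β γ x = 1 := by
  obtain ⟨σ, hσ⟩ := hmin
  simp_rw [Qbar_eq_weight_div]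
  rw [← Finset.sum_div, div_self]
  linarith [one_le_sum_weight (y := y) hσ β γ]

lemma weight_eq_mul_exp_energy (E : Spins N → ℝ) {β : ℝ} (hβ : β ≠ 0) (γ : ℝ) (x : Config N y) :
    weight E β γ x =
      Real.exp (-(N * Real.log (Real.cosh (γ * y)))) * Real.exp (-β * energy E β γ x) := by
  rw [weight, energy, ← Real.exp_add]
  congr 1
  field_simp
  ring

lemma Qbar_vecMul_metropolis (E : Spins N → ℝ) (hN : 1 ≤ N) (hy : 1 ≤ y) {β : ℝ} (hβ : 0 < β)
    (γ : ℝ) (T : ℕ) : (Qbar E β γ : Config N y → ℝ) ᵥ* metropolis E β γ ^ T = Qbar E β γ := by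
  refine MarkovMatrix.vecMul_eq_of_reversible
    (pow_mem (metropolis_mem_rowStochastic E γ hN hy hβ.le) T)
    (MarkovMatrix.reversible_pow (fun x z => ?_) T)
  simp only [Qbar_eq_weight_div, weight_eq_mul_exp_energy E hβ.ne' γ x,
    weight_eq_mul_exp_energy E hβ.ne' γ z, div_mul_eq_mul_div, mul_assoc,
    metropolis_reversible E γ β x z]

lemma exists_tendsto_weight (hE : ∀ σ, 0 ≤ E σ) {β γ : ℕ → ℝ} (hβ : Monotone β)
    (hγ0 : ∀ n, 0 ≤ γ n) (hγ : Monotone γ) (x : Config N y) :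
    ∃ l, Filter.Tendsto (fun n => weight E (β n) (γ n) x) Filter.atTop (nhds l) :=
  ⟨_, tendsto_atTop_ciInf
    (fun _ _ h => weight_anti hE (hβ h) (hγ0 _) (hγ h) x)
    ⟨0, by rintro _ ⟨n, rfl⟩; exact (weight_pos _ _ _ x).le⟩⟩

end Weight

/-! ### The annealing process -/

section Annealing

variable {E : Spins N → ℝ} {β γ : ℕ → ℝ} {T : ℕ → ℕ} {C κ₂ κ₃ : ℝ}

lemma exp_critHeight_le_one (hβ : ∀ n, 0 < β n) (k : ℕ) :
    Real.exp (-β k * critHeight y E (β k) (γ k)) ≤ 1 :=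
  Real.exp_le_one_iff.2 (by nlinarith [hβ k, critHeight_nonneg (y := y) E (β k) (γ k)])

lemma rate_pos (hβ : ∀ n, 0 < β n) (hC0 : 0 < C) (hC1 : C < 1) (k : ℕ) :
    0 < 1 - C * Real.exp (-β k * critHeight y E (β k) (γ k)) := by
  have := mul_le_of_le_one_right hC0.le (exp_critHeight_le_one (y := y) (E := E) (γ := γ) hβ k)
  linarith

lemma uSeq_pos (hβ : ∀ n, 0 < β n) (hC0 : 0 < C) (hC1 : C < 1) (hκ₃ : 0 < κ₃) (n : ℕ) :
    0 < uSeq y E β γ T C κ₃ n :=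
  mul_pos (pow_pos hκ₃ n) (Finset.prod_pos fun k _ => pow_pos (rate_pos hβ hC0 hC1 k) _)

lemma uSeq_succ (n : ℕ) : uSeq y E β γ T C κ₃ (n + 1) =
    κ₃ * (1 - C * Real.exp (-β (n + 1) * critHeight y E (β (n + 1)) (γ (n + 1)))) ^ T (n + 1) *
      uSeq y E β γ T C κ₃ n := by
  unfold uSeq
  rw [Finset.prod_Icc_succ_top (by omega), pow_succ]
  ring

lemma tendsto_uSeq_zero (hβ : ∀ n, 0 < β n) (hC0 : 0 < C) (hC1 : C < 1) (hκ₃ : 0 < κ₃)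
    (hκ₂ : 0 < κ₂) {ν₀ : Config N y → ℝ}
    (h : Filter.Tendsto (errorBound E β γ T ν₀ C κ₂ κ₃) Filter.atTop (nhds 0)) :
    Filter.Tendsto (uSeq y E β γ T C κ₃) Filter.atTop (nhds 0) := by
  have hu := uSeq_pos (y := y) (E := E) (γ := γ) (T := T) hβ hC0 hC1 hκ₃
  set f : ℕ → ℝ := fun k => κ₂ * Real.exp (-(β k * energyGap E + γ k * couplingGap y (γ k))) /
    uSeq y E β γ T C κ₃ k with hf
  have hfpos : ∀ k, 0 < f k := fun k => div_pos (mul_pos hκ₂ (Real.exp_pos _)) (hu k)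
  have h' : Filter.Tendsto (fun n => errorBound E β γ T ν₀ C κ₂ κ₃ n / f 1) Filter.atTop
      (nhds 0) := by simpa using h.div_const (f 1)
  refine squeeze_zero' (Filter.Eventually.of_forall fun n => (hu n).le) ?_ h'
  filter_upwards [Filter.eventually_ge_atTop 1] with n hn
  -- The `k = 1` summand is a fixed positive number, so it alone forces `u_n → 0`.
  rw [le_div_iff₀ (hfpos 1)]
  refine mul_le_mul_of_nonneg_left ?_ (hu n).le
  refine (Finset.single_le_sum (f := f) (fun k _ => (hfpos k).le)
    (Finset.mem_Icc.2 ⟨le_rfl, hn⟩)).trans ?_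
  exact le_add_of_nonneg_right (norm_nonneg _)

lemma sum_law (hN : 1 ≤ N) (hy : 1 ≤ y) (hβ : ∀ n, 0 < β n) {ν₀ : Config N y → ℝ}
    (hν : ∑ x, ν₀ x = 1) (n : ℕ) : ∑ x, law E β γ T ν₀ n x = 1 := by
  induction n with
  | zero => exact hν
  | succ n ih =>
    rw [law, MarkovMatrix.sum_vecMul
      (pow_mem (metropolis_mem_rowStochastic E _ hN hy (hβ _).le) _), ih]

/-- If `u_n → 0`, then `Qbar` and the law of the annealing process converge to a common limit. -/
lemma exists_common_limit (hN : 1 ≤ N) (hy : 1 ≤ y) (hE : ∀ σ, 0 ≤ E σ) (hmin : ∃ σ, E σ = 0)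
    {γ₀ : ℝ} (hγ₀ : 0 < γ₀) (hpair : IsContractionPair y E γ₀ C κ₃)
    (hβ : ∀ n, 0 < β n) (hβm : Monotone β) (hγ : ∀ n, γ₀ ≤ γ n) (hγm : Monotone γ)
    {ν₀ : Config N y → ℝ} (hν : ∑ x, ν₀ x = 1)
    (hu : Filter.Tendsto (uSeq y E β γ T C κ₃) Filter.atTop (nhds 0)) :
    ∃ q : Config N y → ℝ,
      Filter.Tendsto (fun n => (Qbar E (β n) (γ n) : Config N y → ℝ)) Filter.atTop (nhds q) ∧
      Filter.Tendsto (law E β γ T ν₀) Filter.atTop (nhds q) := by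
  have hγ0 : ∀ n, 0 ≤ γ n := fun n => hγ₀.le.trans (hγ n)
  choose l hl using exists_tendsto_weight (y := y) hE hβm hγ0 hγm
  have hZ : Filter.Tendsto (fun n => ∑ x : Config N y, weight E (β n) (γ n) x) Filter.atTop
      (nhds (∑ x, l x)) := tendsto_finsetSum _ fun x _ => hl x
  obtain ⟨σ, hσ⟩ := hmin
  -- The ground state keeps weight one, so the limiting partition function does not vanish.
  have hZ1 : 1 ≤ ∑ x, l x := ge_of_tendsto' hZ fun n => one_le_sum_weight hσ _ _
  have hQ : Filter.Tendsto (fun n => (Qbar E (β n) (γ n) : Config N y → ℝ)) Filter.atTop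
      (nhds fun x => l x / ∑ z, l z) := by
    refine tendsto_pi_nhds.2 fun x => ?_
    simp_rw [Qbar_eq_weight_div]
    exact (hl x).div hZ (by linarith)
  refine ⟨_, hQ, ?_⟩
  have hd : Filter.Tendsto (fun n => law E β γ T ν₀ n - Qbar E (β n) (γ n)) Filter.atTop
      (nhds 0) := by
    refine MarkovMatrix.tendsto_zero_of_contraction
      (P := fun n => metropolis E (β n) (γ n) ^ T n)
      (e := fun n => Qbar E (β n) (γ n) - Qbar E (β (n + 1)) (γ (n + 1)))
      (z := fun n => 2 * ∑ x : Config N y, weight E (β n) (γ n) x)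
      (fun n => pow_mem (metropolis_mem_rowStochastic E _ hN hy (hβ n).le) _)
      (uSeq_pos hβ hpair.C_pos hpair.C_lt_one hpair.κ₃_pos) hu (fun n ρ hρ => ?_) (fun n => ?_)
      (fun n => ?_) (fun n => ?_) (hZ.const_mul 2)
    · have h := mul_le_mul_of_nonneg_right
        (hpair.bound (β (n + 1)) (γ (n + 1)) (hβ _) (hγ _) (T (n + 1)) ρ hρ)
        (uSeq_pos (y := y) (E := E) (γ := γ) (T := T) hβ hpair.C_pos hpair.C_lt_one
          hpair.κ₃_pos n).le
      refine h.trans_eq ?_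
      rw [uSeq_succ]
      ring
    · simp [Finset.sum_sub_distrib, sum_law hN hy hβ hν, sum_Qbar ⟨σ, hσ⟩]
    · rw [sub_add_sub_cancel, sub_vecMul, Qbar_vecMul_metropolis E hN hy (hβ _)]
      rfl
    · simp only [Pi.sub_apply, Qbar_eq_weight_div]
      exact MarkovMatrix.sum_abs_normalized_sub_le (fun x => (weight_pos _ _ _ x).le)
        (weight_anti hE (hβm n.le_succ) (hγ0 n) (hγm n.le_succ)) (one_le_sum_weight hσ _ _)
  simpa using hd.add hQ

/-- On `[0,1]` the convex function `e^{-x}` lies below its chord `1 - (1 - e^{-1}) x`. -/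
lemma exp_neg_le_one_sub_mul {C x : ℝ} (hC : C ≤ 1 - Real.exp (-1)) (hx0 : 0 ≤ x) (hx1 : x ≤ 1) :
    Real.exp (-x) ≤ 1 - C * x := by
  have h := convexOn_exp.2 (Set.mem_univ 0) (Set.mem_univ (-1 : ℝ)) (sub_nonneg.2 hx1) hx0
    (by ring)
  simp only [smul_eq_mul, mul_zero, zero_add, mul_neg, mul_one, Real.exp_zero] at h
  have h2 := mul_le_mul_of_nonneg_right hC hx0
  linarith

lemma le_log_uSeq (hβ : ∀ n, 0 < β n) (hC0 : 0 < C) (hC1 : C < 1) (hC : C ≤ 1 - Real.exp (-1))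
    (hκ₃ : 0 < κ₃) (n : ℕ) :
    -(∑ k ∈ Icc 1 n, (T k : ℝ) * Real.exp (-β k * critHeight y E (β k) (γ k)))
      + (n : ℝ) * Real.log κ₃ ≤ Real.log (uSeq y E β γ T C κ₃ n) := by
  have hr := rate_pos (y := y) (E := E) (γ := γ) hβ hC0 hC1
  unfold uSeq
  rw [Real.log_mul (pow_pos hκ₃ n).ne' (Finset.prod_pos fun k _ => pow_pos (hr k) _).ne',
    Real.log_pow, Real.log_prod fun k _ => (pow_pos (hr k) _).ne', add_comm,
    ← Finset.sum_neg_distrib]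
  refine add_le_add_right (Finset.sum_le_sum fun k _ => ?_) _
  rw [Real.log_pow, ← mul_neg]
  refine mul_le_mul_of_nonneg_left ?_ (Nat.cast_nonneg _)
  rw [Real.le_log_iff_exp_le (hr k)]
  exact exp_neg_le_one_sub_mul hC (Real.exp_pos _).le (exp_critHeight_le_one hβ k)

end Annealing

end ReplicatedSA

end

theorem theorem3p4 (N y : ℕ) (hN : 1 ≤ N) (hy : 2 ≤ y)
    (E : ReplicatedSA.Spins N → ℝ) (hE_nonneg : ∀ σ, 0 ≤ E σ) (hE_min : ∃ σ, E σ = 0)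
    (γ₀ : ℝ) (hγ₀ : 0 < γ₀) :
    (∃ C κ₃ : ℝ, C ≤ 1 - Real.exp (-1) ∧ ReplicatedSA.IsContractionPair y E γ₀ C κ₃) ∧
    ∀ C κ₃ : ℝ, ReplicatedSA.IsContractionPair y E γ₀ C κ₃ →
      ∀ κ₂ : ℝ, 0 < κ₂ →
      ∀ (β γ : ℕ → ℝ) (T : ℕ → ℕ) (ν₀ : ReplicatedSA.Config N y → ℝ),
        (∀ n, 0 < β n) → Monotone β → Filter.Tendsto β Filter.atTop Filter.atTop →
        (∀ n, γ₀ ≤ γ n) → Monotone γ → Filter.Tendsto γ Filter.atTop Filter.atTop →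
        (∀ x, 0 ≤ ν₀ x) → ∑ x, ν₀ x = 1 →
        Filter.Tendsto (ReplicatedSA.errorBound E β γ T ν₀ C κ₂ κ₃) Filter.atTop (nhds 0) →
        (∃ q : ReplicatedSA.Config N y → ℝ,
          Filter.Tendsto
            (fun n => (ReplicatedSA.Qbar E (β n) (γ n) : ReplicatedSA.Config N y → ℝ))
            Filter.atTop (nhds q) ∧
          Filter.Tendsto (ReplicatedSA.law E β γ T ν₀) Filter.atTop (nhds q)) ∧
        (C ≤ 1 - Real.exp (-1) →
          Filter.Tendsto
            (fun n : ℕ =>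
              -(∑ k ∈ Finset.Icc 1 n,
                  (T k : ℝ) * Real.exp (-β k * ReplicatedSA.critHeight y E (β k) (γ k)))
                + (n : ℝ) * Real.log κ₃)
            Filter.atTop Filter.atBot) := by
  refine ⟨ReplicatedSA.exists_isContractionPair hN hy hE_nonneg hE_min hγ₀, ?_⟩
  intro C κ₃ hpair κ₂ hκ₂ β γ T ν₀ hβ hβm _ hγ hγm _ _ hν h
  have hu := ReplicatedSA.tendsto_uSeq_zero hβ hpair.C_pos hpair.C_lt_one hpair.κ₃_pos hκ₂ h
  refine ⟨ReplicatedSA.exists_common_limit hN (by omega) hE_nonneg hE_min hγ₀ hpair hβ hβm hγ hγm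
    hν hu, fun hC => ?_⟩
  have hpos := ReplicatedSA.uSeq_pos (y := y) (E := E) (γ := γ) (T := T) hβ hpair.C_pos
    hpair.C_lt_one hpair.κ₃_pos
  refine Filter.tendsto_atBot_mono
    (ReplicatedSA.le_log_uSeq hβ hpair.C_pos hpair.C_lt_one hC hpair.κ₃_pos) ?_
  exact Real.tendsto_log_nhdsGT_zero.comp
    (tendsto_nhdsWithin_iff.2 ⟨hu, Filter.Eventually.of_forall hpos⟩)
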